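/- Let $H, W_1, W_2$ be real Hilbert spaces, let $A:\mathcal D(A)\subset H\to H$ be a densely defined positive self-adjoint operator with compact inverse, and let $C:W_1\to H$ and $B:W_2\to H$ be bounded linear operators, $B\neq 0$; put $b=\|B\|>0$. Let $\bar\tau\ge 0$, let $\tau:[0,\infty)\to[0,\bar\tau]$ be continuous, and let $k\in L^1_{loc}([-\bar\tau,\infty);\mathbb R)$. Let $\psi:\mathcal D(A^{1/2})\to\mathbb R$ be Gâteaux differentiable and satisfy: (H1) for every $u\in\mathcal D(A^{1/2})$ there is $c(u)>0$ with $|D\psi(u)(v)|\le c(u)\|v\|_H$ for all $v\in \mathcal D(A^{1/2})$; $\nabla\psi(u)\in H$ denotes the unique vector with $D\psi(u)(v)=\langle\nabla\psi(u),v\rangle_H$ for all $v\in\mathcal D(A^{1/2})$; (H2) for every $r>0$ there is $L(r)>0$ with $\|\nabla\psi(u)-\nabla\psi(v)\|_H\le L(r)\|A^{1/2}(u-v)\|_H$ whenever $\|A^{1/2}u\|_H\le r$ and $\|A^{1/2}v\|_H\le r$; (H3) $\psi(0)=0$, $\nabla\psi(0)=0$, and there is a strictly increasing continuous function $h$ on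 $[0,\infty)$ with $\|\nabla\psi(u)\|_H\le h(\|A^{1/2}u\|_H)\,\|A^{1/2}u\|_H$ for all $u\in\mathcal D(A^{1/2})$. Let $u_0\in\mathcal D(A^{1/2})$, $u_1\in H$, $g\in C([-\bar\tau,0];W_2)$, and let $u$ be a solution on $[0,\infty)$ of $$u_{tt}(t)+Au(t)+CC^*u_t(t)+k(t)BB^*u_t(t-\tau(t))=\nabla\psi(u(t)),\quad t\ge0,$$ $$u(0)=u_0,\qquad u_t(0)=u_1,\qquad B^*u_t(s)=g(s)\ \text{ for } s\in[-\bar\tau,0],$$ that is, $u\in C([0,\infty);\mathcal D(A^{1/2}))\cap C^1([0,\infty);H)$ satisfies the initial conditions (in particular $B^*u_1=g(0)$, while for $s<0$ the symbol $B^*u_t(s)$ stands for $g(s)$), and for all $w\in\mathcal D(A)$ and $t\ge0$ $$\langle u_t(t),w\rangle=\langle u_1,w\rangle+\int_0^t\Big(\langle\nabla\psi(u(s)),w\rangle-\langle u(s),Aw\rangle-\langle CC^*u_t(s),w\rangle-k(s)\langle BB^*u_t(s-\tau(s)),w\rangle\Big)ds .$$ Define, for $t\ge 0$, $$E(t)=\tfrac12\|u_t(t)\|_H^2+\tfrac12\|A^{1/2}u(t)\|_H^2-\psi(u(t))+\tfrac12\int_{t-\bar\tau}^t|k(s)|\,\|B^*u_t(s)\|_{W_2}^2\,ds,$$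 $$\mathcal E(t)=\max\Big\{\tfrac14\max_{s\in[-\bar\tau,0]}\|g(s)\|_{W_2}^2,\ b^2\max_{s\in[0,t]}E(s)\Big\},$$ so that $\mathcal E(0)=\max\{\tfrac14\max_{s\in[-\bar\tau,0]}\|g(s)\|_{W_2}^2,\ b^2E(0)\}$. If $E(t)\ge\tfrac14\|u_t(t)\|_H^2$ for all $t\ge0$, then $$E(t)\le\frac1{b^2}\,e^{6b^2\int_0^t|k(s)|\,ds}\,\mathcal E(0)\qquad\text{for all } t\ge0 .$$ -/

import Mathlib

open Set MeasureTheory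
open scoped RealInnerProductSpace

noncomputable section

namespace DelayWave

variable {H : Type*} [NormedAddCommGroup H] [InnerProductSpace ℝ H] [CompleteSpace H]
variable {W₁ : Type*} [NormedAddCommGroup W₁] [InnerProductSpace ℝ W₁] [CompleteSpace W₁]
variable {W₂ : Type*} [NormedAddCommGroup W₂] [InnerProductSpace ℝ W₂] [CompleteSpace W₂]

/-- `A : D(A) ⊂ H → H` is a densely defined positive self-adjoint operator with compact inverse. -/
structure IsAdmissible (A : H →ₗ.[ℝ] H) : Prop where
  dense : Dense (A.domain : Set H)
  selfAdjoint : IsSelfAdjoint A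
  pos : ∀ x : A.domain, x ≠ 0 → 0 < ⟪A x, (x : H)⟫
  compact_inverse : ∃ T : H →L[ℝ] H, IsCompactOperator T ∧
    (∀ y : H, ∃ hy : T y ∈ A.domain, A ⟨T y, hy⟩ = y) ∧ ∀ x : A.domain, T (A x) = x

/-- The eigenspace `ker (A - l)` of an unbounded operator. -/
def eigenspace (A : H →ₗ.[ℝ] H) (l : ℝ) : Submodule ℝ H where
  carrier := {x | ∃ hx : x ∈ A.domain, A ⟨x, hx⟩ = l • x}
  zero_mem' := ⟨A.domain.zero_mem, by
    rw [smul_zero]; exact A.map_zero⟩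
  add_mem' := by
    rintro x y ⟨hx, ex⟩ ⟨hy, ey⟩
    refine ⟨A.domain.add_mem hx hy, ?_⟩
    rw [smul_add, ← ex, ← ey, ← A.map_add]
    rfl
  smul_mem' := by
    rintro c x ⟨hx, ex⟩
    refine ⟨A.domain.smul_mem c hx, ?_⟩
    rw [smul_comm, ← ex, ← A.map_smul]
    rfl

/-- The orthogonal projection onto `ker (A - l)`. (For self-adjoint `A` this eigenspace is
already closed; the closure only makes the definition meaningful for every `A`.) -/
def spectralProj (A : H →ₗ.[ℝ] H) (l : ℝ) : H →L[ℝ] H :=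
  (eigenspace A l).topologicalClosure.starProjection

/-- The square root `A^{1/2} = ∑ l^{1/2} P_l`, where `P_l` is the orthogonal projection onto
`ker (A - l)`, the sum being over all real `l` (only the eigenvalues of `A` contribute). Its
domain consists of the vectors `x` for which `∑ l^{1/2} P_l x` converges unconditionally in `H`;
as eigenspaces of a self-adjoint operator are orthogonal, this means `∑ l ‖P_l x‖² < ∞`. For a
positive self-adjoint operator with compact inverse, which has the spectral decomposition
`A = ∑ l P_l`, this is the positive self-adjoint square root. -/
def sqrtOp (A : H →ₗ.[ℝ] H) : H →ₗ.[ℝ] H where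
  domain :=
    { carrier := {x | Summable fun l : ℝ => √l • spectralProj A l x}
      zero_mem' := by
        simp only [mem_ofPred_eq, map_zero, smul_zero]
        exact summable_zero
      add_mem' := by
        intro x y hx hy
        simp only [mem_ofPred_eq, map_add, smul_add] at *
        exact hx.add hy
      smul_mem' := by
        intro c x hx
        simp only [mem_ofPred_eq, map_smul] at *
        simpa only [smul_comm c] using hx.const_smul c }
  toFun :=
    { toFun := fun x => ∑' l : ℝ, √l • spectralProj A l (x : H)
      map_add' := by
        intro x y
        simp only [Submodule.coe_add, map_add, smul_add]
        exact x.2.tsum_add y.2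
      map_smul' := by
        intro c x
        simp only [Submodule.coe_smul, map_smul, RingHom.id_apply]
        simp only [smul_comm _ c]
        exact x.2.tsum_const_smul c }

/-- The energy space `D(A^{1/2})`. -/
abbrev EnergyDom (A : H →ₗ.[ℝ] H) : Type _ := (sqrtOp A).domain

/-- Assumptions on the nonlinear potential `ψ : D(A^{1/2}) → ℝ` and its gradient `∇ψ`. -/
structure IsPotential (A : H →ₗ.[ℝ] H) (ψ : EnergyDom A → ℝ) (gradψ : EnergyDom A → H) :
    Prop where
  /-- `ψ` is Gâteaux differentiable, each `Dψ(u)` is bounded for the norm of `H`, and `∇ψ(u)` is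
  its Riesz representative in `H` (unique, since `D(A^{1/2})` is dense). -/
  gateaux : ∀ u v : EnergyDom A, HasLineDerivAt ℝ ψ ⟪gradψ u, (v : H)⟫ u v
  locallyLipschitz : ∀ r : ℝ, 0 < r → ∃ L : ℝ, 0 < L ∧ ∀ u v : EnergyDom A,
    ‖sqrtOp A u‖ ≤ r → ‖sqrtOp A v‖ ≤ r → ‖gradψ u - gradψ v‖ ≤ L * ‖sqrtOp A (u - v)‖
  map_zero : ψ 0 = 0
  grad_zero : gradψ 0 = 0
  growth : ∃ h : ℝ → ℝ, StrictMonoOn h (Ici 0) ∧ ContinuousOn h (Ici 0) ∧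
    ∀ u : EnergyDom A, ‖gradψ u‖ ≤ h ‖sqrtOp A u‖ * ‖sqrtOp A u‖

/-- The function `s ↦ B* u_t(s)` on `[-τ̄, ∞)`: it is `g` at negative times. Here `v = u_t`. -/
def observation (B : W₂ →L[ℝ] H) (g : ℝ → W₂) (v : ℝ → H) (s : ℝ) : W₂ :=
  if s < 0 then g s else B.adjoint (v s)

/-- `u`, with velocity `v = u_t`, is a (weak, equivalently mild) solution on `[0, ∞)` of
`u_tt + A u + C C* u_t + k(t) B B* u_t(t - τ(t)) = ∇ψ(u)`, `u(0) = u₀`, `u_t(0) = u₁`,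
`B* u_t = g` on `[-τ̄, 0]`, in the class `C([0,∞); D(A^{1/2})) ∩ C¹([0,∞); H)`. The equation is
tested against the vectors of `D(A)` and integrated in time. Only the values of `u`, `v` at times
`t ≥ 0` are relevant. -/
structure IsSolution (A : H →ₗ.[ℝ] H) (C : W₁ →L[ℝ] H) (B : W₂ →L[ℝ] H) (k τ : ℝ → ℝ)
    (gradψ : EnergyDom A → H) (u₀ : EnergyDom A) (u₁ : H) (g : ℝ → W₂)
    (u : ℝ → EnergyDom A) (v : ℝ → H) : Prop where
  hasDeriv : ∀ t : ℝ, 0 ≤ t → HasDerivWithinAt (fun s => (u s : H)) (v t) (Ici 0) t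
  continuousOn_velocity : ContinuousOn v (Ici 0)
  continuousOn_sqrt : ContinuousOn (fun t => sqrtOp A (u t)) (Ici 0)
  initial_position : u 0 = u₀
  initial_velocity : v 0 = u₁
  /-- `B* u_t(0) = g(0)`; the condition at negative times is built into `observation`. -/
  history : B.adjoint (v 0) = g 0
  equation : ∀ w : A.domain, ∀ t : ℝ, 0 ≤ t →
    ⟪v t, (w : H)⟫ = ⟪u₁, (w : H)⟫ + ∫ s in (0 : ℝ)..t,
      (⟪gradψ (u s), (w : H)⟫ - ⟪(u s : H), A w⟫ - ⟪C (C.adjoint (v s)), (w : H)⟫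
        - k s * ⟪B (observation B g v (s - τ s)), (w : H)⟫)

/-- The energy
`E(t) = ½‖u_t‖² + ½‖A^{1/2}u‖² - ψ(u) + ½ ∫_{t-τ̄}^t |k(s)| ‖B* u_t(s)‖² ds`. -/
def energy (A : H →ₗ.[ℝ] H) (B : W₂ →L[ℝ] H) (k : ℝ → ℝ) (τbar : ℝ) (ψ : EnergyDom A → ℝ)
    (g : ℝ → W₂) (u : ℝ → EnergyDom A) (v : ℝ → H) (t : ℝ) : ℝ :=
  1 / 2 * ‖v t‖ ^ 2 + 1 / 2 * ‖sqrtOp A (u t)‖ ^ 2 - ψ (u t)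
    + 1 / 2 * ∫ s in (t - τbar)..t, |k s| * ‖observation B g v s‖ ^ 2

/-- `𝓔(t) = max {¼ max_{[-τ̄,0]} ‖g‖², b² max_{[0,t]} E}` with `b = ‖B‖`. -/
def energySup (A : H →ₗ.[ℝ] H) (B : W₂ →L[ℝ] H) (k : ℝ → ℝ) (τbar : ℝ) (ψ : EnergyDom A → ℝ)
    (g : ℝ → W₂) (u : ℝ → EnergyDom A) (v : ℝ → H) (t : ℝ) : ℝ :=
  max (1 / 4 * sSup ((fun s => ‖g s‖ ^ 2) '' Icc (-τbar) 0))
    (‖B‖ ^ 2 * sSup (energy A B k τbar ψ g u v '' Icc 0 t))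

end DelayWave

end

/-!
The solution is only weak, so the energy identity cannot be obtained by pairing the equation with
`u_t`. Expand in an orthonormal basis of eigenvectors of `A` instead: each coordinate of `(u, u_t)`
is a driven scalar oscillator, whose energy is absolutely continuous in time, and summing the
coordinates gives the energy identity without any regularity of `u`.

Drop the damping term, which has a sign, and apply Young's inequality to the delay term. The memory
term of `E` grows by at most `½ ∫₀ᵗ |k(s)| ‖B* u_t(s)‖² ds`, so that
`E(t) - E(0) ≤ ∫₀ᵗ |k(s)| (½‖B* u_t(s - τ(s))‖² + ‖B* u_t(s)‖²) ds`. Both squared norms are at most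
`4 𝓔(s)`, by the coercivity `E ≥ ¼‖u_t‖²` at nonnegative times and by the choice of `𝓔` at negative
ones. Since `½ · 4 + 4 = 6`, it follows that `𝓔(t) ≤ 𝓔(0) + 6 b² ∫₀ᵗ |k(s)| 𝓔(s) ds`, and
Gronwall's inequality with an `L¹` kernel concludes.
-/

namespace DelayWave

section Spectral

universe u v w

variable {𝕜 : Type v} {E : Type u} [RCLike 𝕜] [NormedAddCommGroup E] [InnerProductSpace 𝕜 E]
  [CompleteSpace E]

theorem exists_hilbertBasis_of_orthogonalFamily {ι : Type w} {V : ι → Submodule 𝕜 E}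
    [∀ i, CompleteSpace (V i)] (hV : OrthogonalFamily 𝕜 (fun i => V i) fun i => (V i).subtypeₗᵢ)
    (hV_top : (⨆ i, V i)ᗮ = ⊥) :
    ∃ (κ : Type (max u w)) (e : HilbertBasis κ 𝕜 E) (j : κ → ι), ∀ a, e a ∈ V (j a) := by
  choose w b _ using fun i => exists_hilbertBasis 𝕜 (V i)
  have h_orthonormal : Orthonormal 𝕜 fun a : Σ i, w i => (V a.1).subtypeₗᵢ (b a.1 a.2) :=
    hV.orthonormal_sigma_orthonormal fun i => (b i).orthonormal
  have h_total : (Submodule.span 𝕜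
      (range fun a : Σ i, w i => (V a.1).subtypeₗᵢ (b a.1 a.2)))ᗮ = ⊥ := by
    rw [eq_bot_iff, ← hV_top, ← Submodule.iInf_orthogonal]
    refine fun x hx => (Submodule.mem_iInf _).2 fun i => ?_
    have h_zero : (innerSL 𝕜 x).comp (V i).subtypeL = 0 := by
      refine ContinuousLinearMap.ext_on
        ((Submodule.dense_iff_topologicalClosure_eq_top).2 (b i).dense_span) ?_
      rintro _ ⟨a, rfl⟩
      exact (Submodule.mem_orthogonal' _ _).1 hx _ (Submodule.subset_span ⟨⟨i, a⟩, rfl⟩)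
    exact (Submodule.mem_orthogonal' _ _).2 fun y hy => DFunLike.congr_fun h_zero ⟨y, hy⟩
  refine ⟨_, HilbertBasis.mkOfOrthogonalEqBot h_orthonormal h_total, fun a => a.1, fun a => ?_⟩
  rw [HilbertBasis.coe_mkOfOrthogonalEqBot]
  exact (b a.1 a.2).2

theorem exists_hilbertBasis_eigenvectors_of_isCompactOperator {T : E →L[𝕜] E}
    (hT : IsCompactOperator T) (hT_symm : (T : E →ₗ[𝕜] E).IsSymmetric) :
    ∃ (ι : Type (max u v)) (e : HilbertBasis ι 𝕜 E) (μ : ι → 𝕜), ∀ i, T (e i) = μ i • e i := by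
  obtain ⟨ι, e, μ, he⟩ := exists_hilbertBasis_of_orthogonalFamily
    hT_symm.orthogonalFamily_eigenspaces
    (ContinuousLinearMap.orthogonalComplement_iSup_eigenspaces_eq_bot hT hT_symm)
  exact ⟨ι, e, μ, fun i => Module.End.mem_eigenspace_iff.1 (he i)⟩

variable {H : Type u} [NormedAddCommGroup H] [InnerProductSpace ℝ H] {A : H →ₗ.[ℝ] H}

theorem mem_eigenspace_inv_of_rightInverse {T : H → H}
    (hT : ∀ y, ∃ hy : T y ∈ A.domain, A ⟨T y, hy⟩ = y) {x : H} {μ : ℝ} (hx : T x = μ • x) :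
    x ∈ eigenspace A μ⁻¹ := by
  obtain ⟨hTx, hATx⟩ := hT x
  rcases eq_or_ne μ 0 with rfl | hμ
  · have h_zero : (⟨T x, hTx⟩ : A.domain) = 0 := Subtype.ext (hx.trans (zero_smul ℝ x))
    rw [h_zero, A.map_zero] at hATx
    exact hATx ▸ Submodule.zero_mem _
  · have hTx_mem : T x ∈ eigenspace A μ⁻¹ :=
      ⟨hTx, by rw [hATx, hx, inv_smul_smul₀ hμ]⟩
    rw [hx] at hTx_mem
    exact ((eigenspace A μ⁻¹).smul_mem_iff hμ).1 hTx_mem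

/-- A Hilbert basis of eigenvectors `e i`, with eigenvalues `l i ≥ 0`, of a symmetric unbounded
operator `A`; it is what the compactness of `A⁻¹` provides. The basis may be uncountable and `0` may
be an eigenvalue. -/
structure IsNonnegEigenbasis {ι : Type*} (A : H →ₗ.[ℝ] H) (e : HilbertBasis ι ℝ H) (l : ι → ℝ) :
    Prop where
  isFormalAdjoint : A.IsFormalAdjoint A
  nonneg : ∀ i, 0 ≤ l i
  mem_eigenspace : ∀ i, e i ∈ eigenspace A (l i)

variable [CompleteSpace H]

theorem IsAdmissible.isFormalAdjoint (hA : IsAdmissible A) : A.IsFormalAdjoint A := by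
  have h := LinearPMap.adjoint_isFormalAdjoint hA.dense
  rwa [LinearPMap.isSelfAdjoint_def.1 hA.selfAdjoint] at h

theorem IsAdmissible.nonneg_of_mem_eigenspace (hA : IsAdmissible A) {x : H} (hx : x ≠ 0) {l : ℝ}
    (hxl : x ∈ eigenspace A l) : 0 ≤ l := by
  obtain ⟨hxA, hAx⟩ := hxl
  have h_pos := hA.pos ⟨x, hxA⟩ fun h => hx (congrArg Subtype.val h)
  rw [hAx, real_inner_smul_left] at h_pos
  exact (pos_of_mul_pos_left h_pos real_inner_self_nonneg).le

theorem IsAdmissible.exists_isNonnegEigenbasis (hA : IsAdmissible A) :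
    ∃ (ι : Type u) (e : HilbertBasis ι ℝ H) (l : ι → ℝ), IsNonnegEigenbasis A e l := by
  obtain ⟨T, hT, hAT, -⟩ := hA.compact_inverse
  have hT_symm : (T : H →ₗ[ℝ] H).IsSymmetric := by
    intro x y
    obtain ⟨hx, hATx⟩ := hAT x
    obtain ⟨hy, hATy⟩ := hAT y
    have h := hA.isFormalAdjoint ⟨T x, hx⟩ ⟨T y, hy⟩
    rw [hATx, hATy] at h
    exact h.symm
  obtain ⟨ι, e, μ, he⟩ := exists_hilbertBasis_eigenvectors_of_isCompactOperator hT hT_symm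
  have h_mem (i : ι) := mem_eigenspace_inv_of_rightInverse hAT (he i)
  exact ⟨ι, e, fun i => (μ i)⁻¹, hA.isFormalAdjoint,
    fun i => hA.nonneg_of_mem_eigenspace (e.orthonormal.ne_zero i) (h_mem i), h_mem⟩

variable {m : ℝ} {x : H}

theorem spectralProj_apply_of_mem_eigenspace (hA : A.IsFormalAdjoint A)
    (hx : x ∈ eigenspace A m) (l : ℝ) : spectralProj A l x = if l = m then x else 0 := by
  split_ifs with h
  · subst h
    exact Submodule.starProjection_eq_self_iff.2 (Submodule.le_topologicalClosure _ hx)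
  · refine (Submodule.starProjection_apply_eq_zero_iff _).2 ?_
    rw [Submodule.orthogonal_closure, Submodule.mem_orthogonal]
    rintro y ⟨hy, hAy⟩
    obtain ⟨hx, hAx⟩ := hx
    have h_symm := hA ⟨y, hy⟩ ⟨x, hx⟩
    rw [hAy, hAx, real_inner_smul_left, real_inner_smul_right] at h_symm
    exact (mul_eq_zero.1 (by linarith : (l - m) * ⟪y, x⟫ = 0)).resolve_left (sub_ne_zero.2 h)

theorem inner_sqrtOp_of_mem_eigenspace (hA : A.IsFormalAdjoint A) (hx : x ∈ eigenspace A m)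
    (y : EnergyDom A) : ⟪x, sqrtOp A y⟫ = √m * ⟪x, (y : H)⟫ := by
  have h_term (l : ℝ) :
      ⟪x, √l • spectralProj A l (y : H)⟫ = if l = m then √m * ⟪x, (y : H)⟫ else 0 := by
    have h_proj : ⟪x, spectralProj A l (y : H)⟫ = ⟪spectralProj A l x, (y : H)⟫ :=
      (Submodule.inner_starProjection_left_eq_right _ _ _).symm
    rw [real_inner_smul_right, h_proj, spectralProj_apply_of_mem_eigenspace hA hx]
    split_ifs with h
    · rw [h]
    · rw [inner_zero_left, mul_zero]
  have h_summable : Summable fun l : ℝ => √l • spectralProj A l (y : H) := y.2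
  have h_sum : HasSum (fun l : ℝ => ⟪x, √l • spectralProj A l (y : H)⟫) ⟪x, sqrtOp A y⟫ :=
    (innerSL ℝ x).hasSum h_summable.hasSum
  simp only [h_term] at h_sum
  exact h_sum.unique (hasSum_ite_eq m _)

end Spectral

section ScalarCalculus

open Filter Topology

theorem absolutelyContinuousOnInterval_comp_of_lipschitzOnWith {X Y : Type*}
    [PseudoMetricSpace X] [PseudoMetricSpace Y] {φ : X → Y} {F : ℝ → X} {S : Set X} {K : NNReal}
    {a b : ℝ} (hφ : LipschitzOnWith K φ S) (hF : AbsolutelyContinuousOnInterval F a b)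
    (hFS : MapsTo F (uIcc a b) S) : AbsolutelyContinuousOnInterval (φ ∘ F) a b := by
  have h_lim := Tendsto.const_mul (K : ℝ) hF
  rw [mul_zero] at h_lim
  refine squeeze_zero' (Eventually.of_forall fun _ => Finset.sum_nonneg fun _ _ => dist_nonneg)
    ?_ h_lim
  filter_upwards [mem_inf_of_right (mem_principal_self _)] with I hI
  rw [Finset.mul_sum]
  exact Finset.sum_le_sum fun i hi =>
    hφ.dist_le_mul _ (hFS (hI.1 i hi).1) _ (hFS (hI.1 i hi).2)

theorem absolutelyContinuousOnInterval_comp_of_contDiff {φ F : ℝ → ℝ} {a b : ℝ}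
    (hφ : ContDiff ℝ 1 φ) (hF : AbsolutelyContinuousOnInterval F a b) :
    AbsolutelyContinuousOnInterval (φ ∘ F) a b := by
  obtain ⟨M, hM⟩ := hF.exists_bound
  obtain ⟨K, hK⟩ := hφ.contDiffOn.exists_lipschitzOnWith (by decide) (convex_Icc (-M) M)
    isCompact_Icc
  exact absolutelyContinuousOnInterval_comp_of_lipschitzOnWith hK hF fun x hx => abs_le.1 (hM x hx)

theorem integral_eq_sub_of_ae_hasDerivAt {F f : ℝ → ℝ} {a b : ℝ}
    (hF : AbsolutelyContinuousOnInterval F a b)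
    (hf : ∀ᵐ x, x ∈ uIcc a b → HasDerivAt F (f x) x) : ∫ x in a..b, f x = F b - F a := by
  rw [← hF.integral_deriv_eq_sub]
  refine intervalIntegral.integral_congr_ae ?_
  filter_upwards [hf] with x hx hxab
  exact (hx (uIoc_subset_uIcc hxab)).deriv.symm

theorem absolutelyContinuousOnInterval_const_add_integral {f : ℝ → ℝ} {a b : ℝ} (c : ℝ)
    (hf : IntervalIntegrable f volume a b) :
    AbsolutelyContinuousOnInterval (fun x => c + ∫ t in a..x, f t) a b :=
  .fun_add (LipschitzWith.const c).lipschitzOnWith.absolutelyContinuousOnInterval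
    (hf.absolutelyContinuousOnInterval_intervalIntegral left_mem_uIcc)

theorem ae_hasDerivAt_const_add_integral {f : ℝ → ℝ} {a b : ℝ} (c : ℝ)
    (hf : IntervalIntegrable f volume a b) :
    ∀ᵐ x, x ∈ uIcc a b → HasDerivAt (fun x => c + ∫ t in a..x, f t) (f x) x := by
  filter_upwards [hf.ae_hasDerivAt_integral] with x hx hxab
  exact (hx hxab a left_mem_uIcc).const_add c

theorem two_mul_integral_primitive_mul {q f : ℝ → ℝ} {a b : ℝ}
    (hf : IntervalIntegrable f volume a b)
    (hq : ∀ t ∈ uIcc a b, q t = q a + ∫ s in a..t, f s) :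
    2 * ∫ s in a..b, q s * f s = q b ^ 2 - q a ^ 2 := by
  have h_ac := absolutelyContinuousOnInterval_const_add_integral (q a) hf
  have h_ftc := integral_eq_sub_of_ae_hasDerivAt (f := fun s => 2 * (q s * f s))
    (h_ac.fun_mul h_ac) <| by
      filter_upwards [ae_hasDerivAt_const_add_integral (q a) hf] with s hs hsab
      refine ((hs hsab).mul (hs hsab)).congr_deriv ?_
      rw [← hq s hsab]
      ring
  rw [← intervalIntegral.integral_const_mul, h_ftc, ← hq b right_mem_uIcc, ← hq a left_mem_uIcc]
  ring

theorem le_mul_exp_integral_of_le_add_integral {y κ : ℝ → ℝ} {M a b : ℝ} (hab : a ≤ b)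
    (hκ : IntervalIntegrable κ volume a b)
    (hκy : IntervalIntegrable (fun s => κ s * y s) volume a b)
    (hκ_nonneg : ∀ s ∈ Icc a b, 0 ≤ κ s)
    (hy : ∀ t ∈ Icc a b, y t ≤ M + ∫ s in a..t, κ s * y s) :
    y b ≤ M * Real.exp (∫ s in a..b, κ s) := by
  -- `z ≥ y`, so the absolutely continuous function `z e^{-K}` has derivative
  -- `κ (y - z) e^{-K} ≤ 0`.
  set z : ℝ → ℝ := fun t => M + ∫ s in a..t, κ s * y s
  set K : ℝ → ℝ := fun t => 0 + ∫ s in a..t, κ s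
  have h_exp : AbsolutelyContinuousOnInterval (fun t => Real.exp (-K t)) a b :=
    absolutelyContinuousOnInterval_comp_of_contDiff (φ := fun x => Real.exp (-x)) (by fun_prop)
      (absolutelyContinuousOnInterval_const_add_integral 0 hκ)
  have h_ac : AbsolutelyContinuousOnInterval (fun t => z t * Real.exp (-K t)) a b :=
    (absolutelyContinuousOnInterval_const_add_integral M hκy).fun_mul h_exp
  have h_ftc := integral_eq_sub_of_ae_hasDerivAt
    (f := fun t => κ t * (y t - z t) * Real.exp (-K t)) h_ac <| by
      filter_upwards [ae_hasDerivAt_const_add_integral M hκy,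
        ae_hasDerivAt_const_add_integral 0 hκ] with t hz hK htab
      refine ((hz htab).mul (hK htab).fun_neg.exp).congr_deriv ?_
      ring
  have h_decr : z b * Real.exp (-K b) ≤ z a * Real.exp (-K a) := by
    rw [← sub_nonpos, ← h_ftc, ← neg_nonneg, ← intervalIntegral.integral_neg]
    refine intervalIntegral.integral_nonneg hab fun t ht => ?_
    rw [← neg_mul, ← mul_neg]
    exact mul_nonneg (mul_nonneg (hκ_nonneg t ht) (by linarith [hy t ht])) (Real.exp_pos _).le
  calc y b ≤ z b := hy b (right_mem_Icc.2 hab)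
    _ = z b * Real.exp (-K b) * Real.exp (K b) := by
      rw [mul_assoc, ← Real.exp_add, neg_add_cancel, Real.exp_zero, mul_one]
    _ ≤ z a * Real.exp (-K a) * Real.exp (K b) := by gcongr
    _ = M * Real.exp (∫ s in a..b, κ s) := by simp [z, K]

theorem oscillator_energy_identity {p q f : ℝ → ℝ} {l a b : ℝ} (hab : a ≤ b)
    (hf : IntervalIntegrable f volume a b) (hq : ContinuousOn q (Icc a b))
    (hp : ∀ t ∈ Icc a b, HasDerivWithinAt p (q t) (Icc a b) t)
    (heq : ∀ t ∈ Icc a b, q t = q a + ∫ s in a..t, (f s - l * p s)) :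
    q b ^ 2 + l * p b ^ 2 - (q a ^ 2 + l * p a ^ 2) = 2 * ∫ s in a..b, q s * f s := by
  have hp_cont : ContinuousOn p (Icc a b) := fun t ht => (hp t ht).continuousWithinAt
  have h_pq : IntervalIntegrable (fun s => 2 * p s * q s) volume a b :=
    ((continuousOn_const.mul hp_cont).mul hq).intervalIntegrable_of_Icc hab
  have h_potential : ∫ s in a..b, 2 * p s * q s = p b ^ 2 - p a ^ 2 := by
    refine intervalIntegral.integral_eq_sub_of_hasDerivAt_of_le hab (hp_cont.pow 2)
      (fun t ht => ?_) h_pq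
    simpa using ((hp t (Ioo_subset_Icc_self ht)).hasDerivAt (Icc_mem_nhds ht.1 ht.2)).pow 2
  have h_kinetic := two_mul_integral_primitive_mul
    (hf.sub ((hp_cont.intervalIntegrable_of_Icc hab).const_mul l)) (by rwa [uIcc_of_le hab])
  have h_split : ∫ s in a..b, q s * (f s - l * p s) =
      (∫ s in a..b, q s * f s) - l / 2 * ∫ s in a..b, 2 * p s * q s := by
    have h_work : IntervalIntegrable (fun s => q s * f s) volume a b :=
      hf.continuousOn_mul (by rwa [uIcc_of_le hab])
    rw [← intervalIntegral.integral_const_mul,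
      ← intervalIntegral.integral_sub h_work (h_pq.const_mul _)]
    refine intervalIntegral.integral_congr fun s _ => ?_
    ring
  rw [h_split, h_potential] at h_kinetic
  linear_combination -h_kinetic

end ScalarCalculus

section EnergyIdentity

open Filter Topology

section Orthonormal

variable {𝕜 E ι : Type*} [RCLike 𝕜] [NormedAddCommGroup E] [InnerProductSpace 𝕜 E]

theorem countable_setOf_exists_inner_ne_zero {e : ι → E} (he : Orthonormal 𝕜 e) {K : Set E}
    (hK : TopologicalSpace.IsSeparable K) : {i | ∃ x ∈ K, inner 𝕜 (e i) x ≠ 0}.Countable := by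
  obtain ⟨c, hc, hKc⟩ := hK
  have h_support (y : E) : {i | inner 𝕜 (e i) y ≠ 0}.Countable := by
    refine (he.inner_products_summable y).countable_support.mono fun i hi => ?_
    exact pow_ne_zero 2 (norm_ne_zero_iff.2 hi)
  refine (hc.biUnion fun y _ => h_support y).mono ?_
  rintro i ⟨x, hx, hix⟩
  obtain ⟨y, hiy, hyc⟩ := mem_closure_iff.1 (hKc hx) {y | inner 𝕜 (e i) y ≠ 0}
    (isOpen_ne_fun (by fun_prop) (by fun_prop)) hix
  exact mem_biUnion hyc hiy

end Orthonormal

variable {H : Type*} [NormedAddCommGroup H] [InnerProductSpace ℝ H] {ι : Type*}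

theorem abs_sum_inner_mul_inner_le {e : ι → H} (he : Orthonormal ℝ e) (F : Finset ι) (x y : H) :
    |∑ i ∈ F, ⟪x, e i⟫ * ⟪e i, y⟫| ≤ ‖x‖ * ‖y‖ := by
  have h_bessel (z : H) : ∑ i ∈ F, ⟪e i, z⟫ ^ 2 ≤ ‖z‖ ^ 2 := by
    simpa using he.sum_inner_products_le (s := F) z
  refine abs_le_of_sq_le_sq ?_ (by positivity)
  calc (∑ i ∈ F, ⟪x, e i⟫ * ⟪e i, y⟫) ^ 2
      ≤ (∑ i ∈ F, ⟪x, e i⟫ ^ 2) * ∑ i ∈ F, ⟪e i, y⟫ ^ 2 :=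
        Finset.sum_mul_sq_le_sq_mul_sq F _ _
    _ ≤ ‖x‖ ^ 2 * ‖y‖ ^ 2 := by
        simp only [fun i => real_inner_comm (e i) x]
        gcongr <;> exact h_bessel _
    _ = (‖x‖ * ‖y‖) ^ 2 := by ring

variable {f v : ℝ → H} {a b : ℝ}

theorem hasSum_integral_inner_mul_inner_of_orthonormal [Countable ι] {e : ι → H}
    (he : Orthonormal ℝ e) (hf : IntervalIntegrable f volume a b) (hv : ContinuousOn v (uIcc a b))
    (h_sum : ∀ s ∈ uIcc a b, HasSum (fun i => ⟪f s, e i⟫ * ⟪e i, v s⟫) ⟪f s, v s⟫) :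
    HasSum (fun i => ∫ s in a..b, ⟪f s, e i⟫ * ⟪e i, v s⟫) (∫ s in a..b, ⟪f s, v s⟫) := by
  have h_int (i : ι) : IntervalIntegrable (fun s => ⟪f s, e i⟫ * ⟪e i, v s⟫) volume a b :=
    IntervalIntegrable.mul_continuousOn
      ⟨hf.1.inner_const (e i), hf.2.inner_const (e i)⟩ (continuousOn_const.inner hv)
  have h_lim : Tendsto (fun F : Finset ι => ∫ s in a..b, ∑ i ∈ F, ⟪f s, e i⟫ * ⟪e i, v s⟫)
      atTop (𝓝 (∫ s in a..b, ⟪f s, v s⟫)) := by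
    refine intervalIntegral.tendsto_integral_filter_of_dominated_convergence
      (fun s => ‖f s‖ * ‖v s‖) (.of_forall fun F => ?_) (.of_forall fun F => ?_)
      (hf.norm.mul_continuousOn hv.norm) ?_
    · exact Finset.aestronglyMeasurable_fun_sum F fun i _ =>
        (intervalIntegrable_iff.1 (h_int i)).aestronglyMeasurable
    · exact .of_forall fun s _ => abs_sum_inner_mul_inner_le he F _ _
    · exact .of_forall fun s hs => h_sum s (uIoc_subset_uIcc hs)
  exact h_lim.congr fun F => intervalIntegral.integral_finsetSum fun i _ => h_int i

theorem hasSum_integral_inner_mul_inner (e : HilbertBasis ι ℝ H)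
    (hf : IntervalIntegrable f volume a b) (hv : ContinuousOn v (uIcc a b)) :
    HasSum (fun i => ∫ s in a..b, ⟪f s, e i⟫ * ⟪e i, v s⟫) (∫ s in a..b, ⟪f s, v s⟫) := by
  -- Dominated convergence needs a countable index set: keep the directions seen by `v`.
  set S : Set ι := {i | ∃ x ∈ v '' uIcc a b, ⟪e i, x⟫ ≠ 0}
  have h_zero {i : ι} (hi : i ∉ S) {s : ℝ} (hs : s ∈ uIcc a b) : ⟪e i, v s⟫ = 0 :=
    not_not.1 fun h => hi ⟨v s, mem_image_of_mem v hs, h⟩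
  have : Countable S := (countable_setOf_exists_inner_ne_zero e.orthonormal
    (isCompact_uIcc.image_of_continuousOn hv).isSeparable).to_subtype
  have h_sum (s : ℝ) (hs : s ∈ uIcc a b) :
      HasSum (fun i : S => ⟪f s, e i⟫ * ⟪e i, v s⟫) ⟪f s, v s⟫ := by
    refine (hasSum_subtype_iff_of_support_subset fun i hi => ?_).2
      (e.hasSum_inner_mul_inner (f s) (v s))
    by_contra hiS
    exact hi (mul_eq_zero_of_right _ (h_zero hiS hs))
  refine (hasSum_subtype_iff_of_support_subset fun i hi => ?_).1
    (hasSum_integral_inner_mul_inner_of_orthonormal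
      (e.orthonormal.comp _ Subtype.val_injective) hf hv h_sum)
  by_contra hiS
  exact hi ((intervalIntegral.integral_congr (g := fun _ => 0) fun s hs =>
    mul_eq_zero_of_right _ (h_zero hiS hs)).trans intervalIntegral.integral_zero)

variable [CompleteSpace H] {A : H →ₗ.[ℝ] H} {e : HilbertBasis ι ℝ H} {l : ι → ℝ}

theorem IsNonnegEigenbasis.hasSum_energy (he : IsNonnegEigenbasis A e l) (x : H)
    (y : EnergyDom A) :
    HasSum (fun i => ⟪e i, x⟫ ^ 2 + l i * ⟪e i, (y : H)⟫ ^ 2) (‖x‖ ^ 2 + ‖sqrtOp A y‖ ^ 2) := by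
  have h_parseval (z : H) : HasSum (fun i => ⟪e i, z⟫ ^ 2) (‖z‖ ^ 2) := by
    simpa only [real_inner_comm (e _) z, ← sq, real_inner_self_eq_norm_sq]
      using e.hasSum_inner_mul_inner z z
  have h_sqrt (i : ι) : ⟪e i, sqrtOp A y⟫ ^ 2 = l i * ⟪e i, (y : H)⟫ ^ 2 := by
    rw [inner_sqrtOp_of_mem_eigenspace he.isFormalAdjoint (he.mem_eigenspace i), mul_pow,
      Real.sq_sqrt (he.nonneg i)]
  simpa only [h_sqrt] using (h_parseval x).add (h_parseval (sqrtOp A y))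

theorem IsNonnegEigenbasis.energy_identity (he : IsNonnegEigenbasis A e l) {u : ℝ → EnergyDom A}
    (hab : a ≤ b) (hf : IntervalIntegrable f volume a b) (hv : ContinuousOn v (Icc a b))
    (hu : ∀ t ∈ Icc a b, HasDerivWithinAt (fun s => (u s : H)) (v t) (Icc a b) t)
    (heq : ∀ w : A.domain, ∀ t ∈ Icc a b, ⟪v t, (w : H)⟫ = ⟪v a, (w : H)⟫ +
      ∫ s in a..t, (⟪f s, (w : H)⟫ - ⟪(u s : H), A w⟫)) :
    ‖v b‖ ^ 2 + ‖sqrtOp A (u b)‖ ^ 2 - (‖v a‖ ^ 2 + ‖sqrtOp A (u a)‖ ^ 2) =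
      2 * ∫ s in a..b, ⟪f s, v s⟫ := by
  have h_coord (i : ι) : ⟪e i, v b⟫ ^ 2 + l i * ⟪e i, (u b : H)⟫ ^ 2 -
      (⟪e i, v a⟫ ^ 2 + l i * ⟪e i, (u a : H)⟫ ^ 2) =
      2 * ∫ s in a..b, ⟪f s, e i⟫ * ⟪e i, v s⟫ := by
    simp only [mul_comm ⟪f _, e i⟫]
    refine oscillator_energy_identity (p := fun t => ⟪e i, (u t : H)⟫) hab
      ⟨hf.1.inner_const (e i), hf.2.inner_const (e i)⟩ (continuousOn_const.inner hv)
      (fun t ht => (innerSL ℝ (e i)).hasFDerivAt.comp_hasDerivWithinAt t (hu t ht))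
      fun t ht => ?_
    obtain ⟨hi, hAi⟩ := he.mem_eigenspace i
    simpa only [hAi, real_inner_smul_right, real_inner_comm (v _), real_inner_comm (u _ : H)]
      using heq ⟨e i, hi⟩ t ht
  have h_sum := (he.hasSum_energy (v b) (u b)).sub (he.hasSum_energy (v a) (u a))
  simp only [h_coord] at h_sum
  exact h_sum.unique
    ((hasSum_integral_inner_mul_inner e hf (by rwa [uIcc_of_le hab])).mul_left 2)

end EnergyIdentity

section Potential

open Filter Topology

variable {H F : Type*} [NormedAddCommGroup H] [InnerProductSpace ℝ H] [NormedAddCommGroup F]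
  [NormedSpace ℝ F] {S : H →ₗ.[ℝ] F} {ψ : S.domain → ℝ} {gradψ : S.domain → H}

/-- `gradψ` is the Gâteaux gradient, taken in the ambient space `H`, of a potential `ψ` on the
domain of `S`, and it is Lipschitz on the balls of the seminorm `‖S ·‖`. -/
structure HasLocallyLipschitzGradient (S : H →ₗ.[ℝ] F) (ψ : S.domain → ℝ)
    (gradψ : S.domain → H) : Prop where
  hasLineDerivAt : ∀ x w : S.domain, HasLineDerivAt ℝ ψ ⟪gradψ x, (w : H)⟫ x w
  exists_norm_sub_le : ∀ r : ℝ, 0 < r → ∃ L : ℝ, 0 < L ∧ ∀ x y : S.domain,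
    ‖S x‖ ≤ r → ‖S y‖ ≤ r → ‖gradψ x - gradψ y‖ ≤ L * ‖S (x - y)‖

theorem HasLocallyLipschitzGradient.hasDerivAt_segment
    (hψ : HasLocallyLipschitzGradient S ψ gradψ) (x w : S.domain) (θ : ℝ) :
    HasDerivAt (fun s : ℝ => ψ (x + s • w)) ⟪gradψ (x + θ • w), (w : H)⟫ θ := by
  have h_line : HasDerivAt (fun s : ℝ => ψ (x + θ • w + s • w))
      ⟪gradψ (x + θ • w), (w : H)⟫ (θ - θ) := by
    rw [sub_self]
    exact hψ.hasLineDerivAt (x + θ • w) w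
  refine (h_line.comp_sub_const θ θ).congr_of_eventuallyEq (.of_forall fun s => ?_)
  exact congrArg ψ (by module)

theorem norm_apply_segment_le {r : ℝ} {x y : S.domain} (hx : ‖S x‖ ≤ r)
    (hy : ‖S y‖ ≤ r) {θ : ℝ} (hθ : θ ∈ Icc (0 : ℝ) 1) : ‖S (x + θ • (y - x))‖ ≤ r := by
  rw [S.map_add, S.map_smul, S.map_sub, ← mem_closedBall_zero_iff]
  exact (convex_closedBall (0 : F) r).add_smul_sub_mem (mem_closedBall_zero_iff.2 hx)
    (mem_closedBall_zero_iff.2 hy) hθ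

theorem HasLocallyLipschitzGradient.abs_sub_sub_inner_le
    (hψ : HasLocallyLipschitzGradient S ψ gradψ) {r L : ℝ} (hL_nonneg : 0 ≤ L)
    (hL : ∀ x y : S.domain, ‖S x‖ ≤ r → ‖S y‖ ≤ r → ‖gradψ x - gradψ y‖ ≤ L * ‖S (x - y)‖)
    {x y : S.domain} (hx : ‖S x‖ ≤ r) (hy : ‖S y‖ ≤ r) :
    |ψ y - ψ x - ⟪gradψ x, (y : H) - x⟫| ≤ L * ‖S (y - x)‖ * ‖(y : H) - x‖ := by
  have h_deriv (θ : ℝ) :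
      HasDerivAt (fun s : ℝ => ψ (x + s • (y - x)) - s * ⟪gradψ x, (y : H) - x⟫)
        (⟪gradψ (x + θ • (y - x)), (y : H) - x⟫ - ⟪gradψ x, (y : H) - x⟫) θ :=
    (hψ.hasDerivAt_segment x (y - x) θ).fun_sub (hasDerivAt_mul_const ⟪gradψ x, (y : H) - x⟫)
  have h_bound (θ : ℝ) (hθ : θ ∈ Ico (0 : ℝ) 1) :
      ‖⟪gradψ (x + θ • (y - x)), (y : H) - x⟫ - ⟪gradψ x, (y : H) - x⟫‖ ≤
        L * ‖S (y - x)‖ * ‖(y : H) - x‖ := by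
    rw [← inner_sub_left]
    refine (norm_inner_le_norm _ _).trans (mul_le_mul_of_nonneg_right ?_ (norm_nonneg _))
    refine (hL _ _ (norm_apply_segment_le hx hy (Ico_subset_Icc_self hθ)) hx).trans ?_
    rw [add_sub_cancel_left, S.map_smul, norm_smul, Real.norm_of_nonneg hθ.1]
    exact mul_le_mul_of_nonneg_left (mul_le_of_le_one_left (norm_nonneg _) hθ.2.le) hL_nonneg
  have h_mvt := norm_image_sub_le_of_norm_deriv_le_segment'
    (fun θ _ => (h_deriv θ).hasDerivWithinAt) h_bound 1 (right_mem_Icc.2 zero_le_one)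
  simp only [one_smul, zero_smul, add_zero, one_mul, zero_mul, sub_zero, mul_one,
    add_sub_cancel, Real.norm_eq_abs] at h_mvt
  rwa [sub_right_comm] at h_mvt

variable {u : ℝ → S.domain} {s : Set ℝ} {t : ℝ}

theorem tendsto_norm_apply_sub (hS : ContinuousOn (fun t => S (u t)) s) (ht : t ∈ s) :
    Tendsto (fun r => ‖S (u r - u t)‖) (𝓝[s] t) (𝓝 0) := by
  simpa only [S.map_sub] using tendsto_iff_norm_sub_tendsto_zero.1 (hS t ht).tendsto

theorem eventually_norm_apply_le (hS : ContinuousOn (fun t => S (u t)) s) (ht : t ∈ s) :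
    ∀ᶠ r in 𝓝[s] t, ‖S (u r)‖ ≤ ‖S (u t)‖ + 1 :=
  ((hS t ht).tendsto.norm.eventually_lt_const (lt_add_one _)).mono fun _ h => h.le

theorem HasLocallyLipschitzGradient.continuousOn_gradient_comp
    (hψ : HasLocallyLipschitzGradient S ψ gradψ) (hS : ContinuousOn (fun t => S (u t)) s) :
    ContinuousOn (fun t => gradψ (u t)) s := by
  intro t ht
  obtain ⟨L, -, hL⟩ := hψ.exists_norm_sub_le (‖S (u t)‖ + 1) (by positivity)
  refine tendsto_iff_norm_sub_tendsto_zero.2 ?_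
  have h_lim := (tendsto_norm_apply_sub hS ht).const_mul L
  rw [mul_zero] at h_lim
  refine squeeze_zero' (.of_forall fun _ => norm_nonneg _) ?_ h_lim
  filter_upwards [eventually_norm_apply_le hS ht] with r hr
  exact hL _ _ hr (le_add_of_nonneg_right zero_le_one)

theorem HasLocallyLipschitzGradient.isLittleO_sub_sub_inner
    (hψ : HasLocallyLipschitzGradient S ψ gradψ) (hS : ContinuousOn (fun t => S (u t)) s)
    (ht : t ∈ s) :
    (fun r => ψ (u r) - ψ (u t) - ⟪gradψ (u t), (u r : H) - u t⟫) =o[𝓝[s] t]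
      fun r => (u r : H) - u t := by
  obtain ⟨L, hL_pos, hL⟩ := hψ.exists_norm_sub_le (‖S (u t)‖ + 1) (by positivity)
  have h_small : (fun r => L * ‖S (u r - u t)‖) =o[𝓝[s] t] fun _ => (1 : ℝ) := by
    rw [Asymptotics.isLittleO_one_iff]
    simpa only [mul_zero] using (tendsto_norm_apply_sub hS ht).const_mul L
  have h_product := h_small.mul_isBigO
    (Asymptotics.isBigO_refl (fun r => ‖(u r : H) - u t‖) (𝓝[s] t))
  simp only [one_mul] at h_product
  refine (Asymptotics.IsBigO.of_norm_eventuallyLE ?_).trans_isLittleO h_product.of_norm_right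
  filter_upwards [eventually_norm_apply_le hS ht] with r hr
  exact hψ.abs_sub_sub_inner_le hL_pos.le hL (le_add_of_nonneg_right zero_le_one) hr

theorem HasLocallyLipschitzGradient.hasDerivWithinAt_comp
    (hψ : HasLocallyLipschitzGradient S ψ gradψ) (hS : ContinuousOn (fun t => S (u t)) s)
    (ht : t ∈ s) {v : H} (hu : HasDerivWithinAt (fun r => (u r : H)) v s t) :
    HasDerivWithinAt (fun r => ψ (u r)) ⟪gradψ (u t), v⟫ s t := by
  have h_linear : HasDerivWithinAt (fun r => ⟪gradψ (u t), (u r : H)⟫) ⟪gradψ (u t), v⟫ s t :=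
    (innerSL ℝ (gradψ (u t))).hasFDerivAt.comp_hasDerivWithinAt t hu
  have h_remainder : HasDerivWithinAt (fun r => ψ (u r) - ⟪gradψ (u t), (u r : H)⟫) 0 s t := by
    rw [hasDerivWithinAt_iff_isLittleO]
    refine ((hψ.isLittleO_sub_sub_inner hS ht).trans_isBigO
      hu.hasFDerivWithinAt.isBigO_sub).congr_left fun r => ?_
    rw [inner_sub_right, smul_zero]
    ring
  simpa only [sub_add_cancel, zero_add] using h_remainder.fun_add h_linear

variable [CompleteSpace H]

theorem IsPotential.hasLocallyLipschitzGradient {A : H →ₗ.[ℝ] H} {ψ : EnergyDom A → ℝ}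
    {gradψ : EnergyDom A → H} (hψ : IsPotential A ψ gradψ) :
    HasLocallyLipschitzGradient (sqrtOp A) ψ gradψ :=
  ⟨hψ.gateaux, hψ.locallyLipschitz⟩

end Potential

section IntervalIntegral

theorem intervalIntegrable_of_locallyIntegrableOn_Ici {E : Type*} [NormedAddCommGroup E]
    {f : ℝ → E} {a b c : ℝ} (hf : LocallyIntegrableOn f (Ici c)) (ha : c ≤ a) (hb : c ≤ b) :
    IntervalIntegrable f volume a b :=
  intervalIntegrable_iff.2 <| (hf.integrableOn_compact_subset
    (fun _ hx => (le_min ha hb).trans hx.1) isCompact_uIcc).mono_set uIoc_subset_uIcc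

theorem intervalIntegrable_mul_of_monotoneOn {f y : ℝ → ℝ} {a b : ℝ}
    (hf : IntervalIntegrable f volume a b) (hy : MonotoneOn y (uIcc a b)) :
    IntervalIntegrable (fun s => f s * y s) volume a b :=
  intervalIntegrable_iff.2 <| (intervalIntegrable_iff.1 hf).mul_of_top_left <|
    (hy.memLp_isCompact isCompact_uIcc).mono_measure (Measure.restrict_mono_set _ uIoc_subset_uIcc)

theorem integral_window_le {φ : ℝ → ℝ} {a b d : ℝ} (hd : 0 ≤ d) (hab : a ≤ b)
    (hφ : IntervalIntegrable φ volume (a - d) b)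
    (h_nonneg : ∀ s ∈ Icc (a - d) (b - d), 0 ≤ φ s) :
    ∫ s in (b - d)..b, φ s ≤ (∫ s in (a - d)..a, φ s) + ∫ s in a..b, φ s := by
  have h_sub {c₁ c₂ : ℝ} (h₁ : c₁ ∈ Icc (a - d) b) (h₂ : c₂ ∈ Icc (a - d) b) :
      IntervalIntegrable φ volume c₁ c₂ :=
    hφ.mono_set <| (uIcc_subset_Icc h₁ h₂).trans Icc_subset_uIcc
  have h_left : a - d ∈ Icc (a - d) b := ⟨le_rfl, by linarith⟩
  have h_right : b ∈ Icc (a - d) b := ⟨by linarith, le_rfl⟩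
  have h_mid : b - d ∈ Icc (a - d) b := ⟨by linarith, by linarith⟩
  have h_start : a ∈ Icc (a - d) b := ⟨by linarith, hab⟩
  rw [intervalIntegral.integral_add_adjacent_intervals (h_sub h_left h_start)
      (h_sub h_start h_right),
    ← intervalIntegral.integral_add_adjacent_intervals (h_sub h_left h_mid)
      (h_sub h_mid h_right)]
  exact le_add_of_nonneg_left (intervalIntegral.integral_nonneg (by linarith) h_nonneg)

theorem continuousOn_integral_window {E : Type*} [NormedAddCommGroup E] [NormedSpace ℝ E]
    {φ : ℝ → E} {a b d : ℝ} (hd : 0 ≤ d) (hab : a ≤ b)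
    (hφ : IntervalIntegrable φ volume (a - d) b) :
    ContinuousOn (fun t => ∫ s in (t - d)..t, φ s) (Icc a b) := by
  have h_primitive : ContinuousOn (fun t => ∫ s in (a - d)..t, φ s) (Icc (a - d) b) := by
    simpa only [uIcc_of_le (by linarith : a - d ≤ b)] using
      intervalIntegral.continuousOn_primitive_interval' hφ left_mem_uIcc
  have h_int {t : ℝ} (ht : t ∈ Icc (a - d) b) : IntervalIntegrable φ volume (a - d) t :=
    hφ.mono_set (uIcc_subset_uIcc_left (Icc_subset_uIcc ht))
  have h_end {t : ℝ} (ht : t ∈ Icc a b) : t ∈ Icc (a - d) b := ⟨by linarith [ht.1], ht.2⟩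
  have h_start {t : ℝ} (ht : t ∈ Icc a b) : t - d ∈ Icc (a - d) b :=
    ⟨by linarith [ht.1], by linarith [ht.2]⟩
  refine ((h_primitive.mono fun t ht => h_end ht).sub
    (h_primitive.comp (by fun_prop) fun t ht => h_start ht)).congr fun t ht => ?_
  exact (intervalIntegral.integral_interval_sub_left (h_int (h_end ht)) (h_int (h_start ht))).symm

end IntervalIntegral

section DelayEstimate

theorem neg_mul_inner_le {W : Type*} [NormedAddCommGroup W] [InnerProductSpace ℝ W] (c : ℝ)
    (x y : W) : -(c * ⟪x, y⟫) ≤ |c| * (1 / 2 * ‖x‖ ^ 2 + 1 / 2 * ‖y‖ ^ 2) :=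
  calc -(c * ⟪x, y⟫) ≤ |c * ⟪x, y⟫| := neg_le_abs _
    _ = |c| * |⟪x, y⟫| := abs_mul _ _
    _ ≤ |c| * (‖x‖ * ‖y‖) := by gcongr; exact abs_real_inner_le_norm x y
    _ ≤ |c| * (1 / 2 * ‖x‖ ^ 2 + 1 / 2 * ‖y‖ ^ 2) := by
        gcongr
        linarith [two_mul_le_add_sq ‖x‖ ‖y‖]

variable {H : Type*} [NormedAddCommGroup H] [InnerProductSpace ℝ H] [CompleteSpace H]
  {W₁ : Type*} [NormedAddCommGroup W₁] [InnerProductSpace ℝ W₁] [CompleteSpace W₁]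
  {W₂ : Type*} [NormedAddCommGroup W₂] [InnerProductSpace ℝ W₂] [CompleteSpace W₂]
  {A : H →ₗ.[ℝ] H} {C : W₁ →L[ℝ] H} {B : W₂ →L[ℝ] H} {k τ : ℝ → ℝ} {τbar T : ℝ}
  {ψ : EnergyDom A → ℝ} {gradψ : EnergyDom A → H} {u₀ : EnergyDom A} {u₁ : H} {g : ℝ → W₂}
  {u : ℝ → EnergyDom A} {v : ℝ → H} {ι : Type*} {e : HilbertBasis ι ℝ H} {l : ι → ℝ}

/-- The energy without its memory term, `½‖v‖² + ½‖A^{1/2}u‖² - ψ(u)`, along a trajectory `u` with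
velocity `v`. -/
noncomputable def mechanicalEnergy (A : H →ₗ.[ℝ] H) (ψ : EnergyDom A → ℝ) (u : ℝ → EnergyDom A)
    (v : ℝ → H) (t : ℝ) : ℝ :=
  1 / 2 * ‖v t‖ ^ 2 + 1 / 2 * ‖sqrtOp A (u t)‖ ^ 2 - ψ (u t)

theorem observation_of_nonneg {s : ℝ} (hs : 0 ≤ s) : observation B g v s = B.adjoint (v s) :=
  if_neg hs.not_gt

theorem continuousOn_observation (hg : ContinuousOn g (Icc (-τbar) 0))
    (hv : ContinuousOn v (Ici 0)) (h_zero : B.adjoint (v 0) = g 0) :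
    ContinuousOn (observation B g v) (Ici (-τbar)) := by
  have h_past : ContinuousOn (observation B g v) (Icc (-τbar) 0) := by
    refine hg.congr fun s hs => ?_
    rcases hs.2.lt_or_eq with h_neg | rfl
    · exact if_pos h_neg
    · rw [observation_of_nonneg le_rfl, h_zero]
  have h_future : ContinuousOn (observation B g v) (Ici 0) :=
    (B.adjoint.continuous.comp_continuousOn hv).congr fun s hs => observation_of_nonneg hs
  refine (h_past.union_of_isClosed h_future isClosed_Icc isClosed_Ici).mono fun s hs => ?_
  exact (le_total s 0).imp (fun h => ⟨hs, h⟩) id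

theorem continuousOn_observation_sub_delay (hg : ContinuousOn g (Icc (-τbar) 0))
    (hv : ContinuousOn v (Ici 0)) (h_zero : B.adjoint (v 0) = g 0)
    (hτ_cont : ContinuousOn τ (Ici 0)) (hτ : ∀ t : ℝ, 0 ≤ t → τ t ≤ τbar) :
    ContinuousOn (fun s => observation B g v (s - τ s)) (Ici 0) :=
  (continuousOn_observation hg hv h_zero).comp (continuousOn_id.sub hτ_cont) fun s hs => by
    simp only [mem_Ici] at hs ⊢
    linarith [hτ s hs]

theorem intervalIntegrable_abs_mul_sq_norm_observation (hg : ContinuousOn g (Icc (-τbar) 0))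
    (hv : ContinuousOn v (Ici 0)) (h_zero : B.adjoint (v 0) = g 0)
    (hk : LocallyIntegrableOn k (Ici (-τbar))) {a b : ℝ} (ha : -τbar ≤ a) (hb : -τbar ≤ b) :
    IntervalIntegrable (fun s => |k s| * ‖observation B g v s‖ ^ 2) volume a b :=
  (intervalIntegrable_of_locallyIntegrableOn_Ici hk ha hb).abs.mul_continuousOn
    (((continuousOn_observation hg hv h_zero).norm.pow 2).mono
      fun _ hs => (le_min ha hb).trans hs.1)

namespace IsSolution

theorem continuousOn_potential (hψ : HasLocallyLipschitzGradient (sqrtOp A) ψ gradψ)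
    (hu : IsSolution A C B k τ gradψ u₀ u₁ g u v) : ContinuousOn (fun t => ψ (u t)) (Ici 0) :=
  fun t ht => (hψ.hasDerivWithinAt_comp hu.continuousOn_sqrt ht
    (hu.hasDeriv t ht)).continuousWithinAt

theorem intervalIntegrable_inner_gradient
    (hψ : HasLocallyLipschitzGradient (sqrtOp A) ψ gradψ)
    (hu : IsSolution A C B k τ gradψ u₀ u₁ g u v) (hT : 0 ≤ T) :
    IntervalIntegrable (fun s => ⟪gradψ (u s), v s⟫) volume 0 T := by
  refine ContinuousOn.intervalIntegrable_of_Icc hT ?_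
  exact ((hψ.continuousOn_gradient_comp hu.continuousOn_sqrt).inner
    hu.continuousOn_velocity).mono Icc_subset_Ici_self

theorem integral_inner_gradient (hψ : HasLocallyLipschitzGradient (sqrtOp A) ψ gradψ)
    (hu : IsSolution A C B k τ gradψ u₀ u₁ g u v) (hT : 0 ≤ T) :
    ∫ s in (0 : ℝ)..T, ⟪gradψ (u s), v s⟫ = ψ (u T) - ψ (u 0) :=
  intervalIntegral.integral_eq_sub_of_hasDerivAt_of_le hT
    ((hu.continuousOn_potential hψ).mono Icc_subset_Ici_self)
    (fun t ht => (hψ.hasDerivWithinAt_comp hu.continuousOn_sqrt ht.1.le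
      (hu.hasDeriv t ht.1.le)).hasDerivAt (Ici_mem_nhds ht.1))
    (hu.intervalIntegrable_inner_gradient hψ hT)

theorem intervalIntegrable_dissipation (hu : IsSolution A C B k τ gradψ u₀ u₁ g u v)
    (hT : 0 ≤ T) (hk : IntervalIntegrable k volume 0 T)
    (h_delay : ContinuousOn (fun s => observation B g v (s - τ s)) (Icc 0 T)) :
    IntervalIntegrable (fun s => ‖C.adjoint (v s)‖ ^ 2 +
      k s * ⟪observation B g v (s - τ s), B.adjoint (v s)⟫) volume 0 T := by
  have hv : ContinuousOn v (Icc 0 T) := hu.continuousOn_velocity.mono Icc_subset_Ici_self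
  refine (ContinuousOn.intervalIntegrable_of_Icc hT ?_).add (hk.mul_continuousOn ?_)
  · exact (C.adjoint.continuous.comp_continuousOn hv).norm.pow 2
  · rw [uIcc_of_le hT]
    exact h_delay.inner (B.adjoint.continuous.comp_continuousOn hv)

theorem mechanicalEnergy_sub_eq (he : IsNonnegEigenbasis A e l)
    (hψ : HasLocallyLipschitzGradient (sqrtOp A) ψ gradψ)
    (hu : IsSolution A C B k τ gradψ u₀ u₁ g u v) (hT : 0 ≤ T)
    (hk : IntervalIntegrable k volume 0 T)
    (h_delay : ContinuousOn (fun s => observation B g v (s - τ s)) (Icc 0 T)) :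
    mechanicalEnergy A ψ u v T - mechanicalEnergy A ψ u v 0 =
      -∫ s in (0 : ℝ)..T, (‖C.adjoint (v s)‖ ^ 2 +
        k s * ⟪observation B g v (s - τ s), B.adjoint (v s)⟫) := by
  set f : ℝ → H := fun s =>
    gradψ (u s) - C (C.adjoint (v s)) - k s • B (observation B g v (s - τ s))
  have h_sub : Icc 0 T ⊆ Ici 0 := Icc_subset_Ici_self
  have hv : ContinuousOn v (Icc 0 T) := hu.continuousOn_velocity.mono h_sub
  have hf : IntervalIntegrable f volume 0 T := by
    refine .sub (.sub ?_ ?_) (hk.smul_continuousOn ?_)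
    · exact ((hψ.continuousOn_gradient_comp hu.continuousOn_sqrt).mono
        h_sub).intervalIntegrable_of_Icc hT
    · exact ((C.comp C.adjoint).continuous.comp_continuousOn hv).intervalIntegrable_of_Icc hT
    · rw [uIcc_of_le hT]
      exact B.continuous.comp_continuousOn h_delay
  have h_linear := he.energy_identity (u := u) hT hf hv
    (fun t ht => (hu.hasDeriv t ht.1).mono h_sub) fun w t ht => by
      rw [hu.equation w t ht.1, hu.initial_velocity]
      congr 2 with s
      simp only [f, inner_sub_left, real_inner_smul_left]
      ring
  have h_work : ∫ s in (0 : ℝ)..T, ⟪f s, v s⟫ = ψ (u T) - ψ (u 0) -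
      ∫ s in (0 : ℝ)..T, (‖C.adjoint (v s)‖ ^ 2 +
        k s * ⟪observation B g v (s - τ s), B.adjoint (v s)⟫) := by
    rw [← hu.integral_inner_gradient hψ hT, ← intervalIntegral.integral_sub
      (hu.intervalIntegrable_inner_gradient hψ hT)
      (hu.intervalIntegrable_dissipation hT hk h_delay)]
    congr 1 with s
    simp only [f, inner_sub_left, real_inner_smul_left, ← C.adjoint_inner_right,
      ← B.adjoint_inner_right, real_inner_self_eq_norm_sq]
    ring
  unfold mechanicalEnergy
  linarith

theorem mechanicalEnergy_sub_le (he : IsNonnegEigenbasis A e l)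
    (hψ : HasLocallyLipschitzGradient (sqrtOp A) ψ gradψ)
    (hu : IsSolution A C B k τ gradψ u₀ u₁ g u v) (hT : 0 ≤ T)
    (hk : IntervalIntegrable k volume 0 T)
    (h_delay : ContinuousOn (fun s => observation B g v (s - τ s)) (Icc 0 T)) :
    mechanicalEnergy A ψ u v T - mechanicalEnergy A ψ u v 0 ≤
      ∫ s in (0 : ℝ)..T, |k s| * (1 / 2 * ‖observation B g v (s - τ s)‖ ^ 2 +
        1 / 2 * ‖observation B g v s‖ ^ 2) := by
  rw [hu.mechanicalEnergy_sub_eq he hψ hT hk h_delay, ← intervalIntegral.integral_neg]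
  refine intervalIntegral.integral_mono_on hT
    (hu.intervalIntegrable_dissipation hT hk h_delay).neg (hk.abs.mul_continuousOn ?_)
    fun s hs => ?_
  · rw [uIcc_of_le hT]
    have h_obs : ContinuousOn (observation B g v) (Icc 0 T) :=
      (B.adjoint.continuous.comp_continuousOn
        (hu.continuousOn_velocity.mono Icc_subset_Ici_self)).congr
        fun s hs => observation_of_nonneg hs.1
    fun_prop
  · rw [observation_of_nonneg hs.1, neg_add]
    linarith [sq_nonneg ‖C.adjoint (v s)‖,
      neg_mul_inner_le (k s) (observation B g v (s - τ s)) (B.adjoint (v s))]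

theorem energy_sub_le (he : IsNonnegEigenbasis A e l)
    (hψ : HasLocallyLipschitzGradient (sqrtOp A) ψ gradψ)
    (hu : IsSolution A C B k τ gradψ u₀ u₁ g u v) (hτbar : 0 ≤ τbar)
    (hτ_cont : ContinuousOn τ (Ici 0)) (hτ : ∀ t : ℝ, 0 ≤ t → τ t ≤ τbar)
    (hk : LocallyIntegrableOn k (Ici (-τbar))) (hg : ContinuousOn g (Icc (-τbar) 0))
    (hT : 0 ≤ T) :
    energy A B k τbar ψ g u v T - energy A B k τbar ψ g u v 0 ≤
      ∫ s in (0 : ℝ)..T, |k s| * (1 / 2 * ‖observation B g v (s - τ s)‖ ^ 2 +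
        ‖observation B g v s‖ ^ 2) := by
  have hkT : IntervalIntegrable k volume 0 T :=
    intervalIntegrable_of_locallyIntegrableOn_Ici hk (by linarith) (by linarith)
  have h_obs : ContinuousOn (observation B g v) (uIcc 0 T) :=
    (continuousOn_observation hg hu.continuousOn_velocity hu.history).mono fun s hs => by
      rw [uIcc_of_le hT] at hs
      exact (neg_nonpos.2 hτbar).trans hs.1
  have h_delay : ContinuousOn (fun s => observation B g v (s - τ s)) (Icc 0 T) :=
    (continuousOn_observation_sub_delay hg hu.continuousOn_velocity hu.history hτ_cont
      hτ).mono Icc_subset_Ici_self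
  have h_delay_uIcc : ContinuousOn (fun s => observation B g v (s - τ s)) (uIcc 0 T) := by
    rwa [uIcc_of_le hT]
  have h_split : ∫ s in (0 : ℝ)..T, |k s| * (1 / 2 * ‖observation B g v (s - τ s)‖ ^ 2 +
        ‖observation B g v s‖ ^ 2) =
      (∫ s in (0 : ℝ)..T, |k s| * (1 / 2 * ‖observation B g v (s - τ s)‖ ^ 2 +
        1 / 2 * ‖observation B g v s‖ ^ 2)) +
      1 / 2 * ∫ s in (0 : ℝ)..T, |k s| * ‖observation B g v s‖ ^ 2 := by
    rw [← intervalIntegral.integral_const_mul, ← intervalIntegral.integral_add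
      (hkT.abs.mul_continuousOn (by fun_prop))
      ((hkT.abs.mul_continuousOn (by fun_prop)).const_mul _)]
    congr 1 with s
    ring
  have h_window := integral_window_le hτbar hT
    (intervalIntegrable_abs_mul_sq_norm_observation hg hu.continuousOn_velocity hu.history hk
      (by linarith) (by linarith)) fun s _ => by positivity
  have h_mechanical := hu.mechanicalEnergy_sub_le he hψ hT hkT h_delay
  rw [h_split]
  unfold mechanicalEnergy at h_mechanical
  unfold energy
  linarith

theorem continuousOn_energy (hψ : HasLocallyLipschitzGradient (sqrtOp A) ψ gradψ)
    (hu : IsSolution A C B k τ gradψ u₀ u₁ g u v) (hτbar : 0 ≤ τbar)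
    (hk : LocallyIntegrableOn k (Ici (-τbar))) (hg : ContinuousOn g (Icc (-τbar) 0))
    (hT : 0 ≤ T) : ContinuousOn (energy A B k τbar ψ g u v) (Icc 0 T) := by
  have h_window := continuousOn_integral_window hτbar hT
    (intervalIntegrable_abs_mul_sq_norm_observation hg hu.continuousOn_velocity hu.history hk
      (by linarith) (by linarith))
  have h_mechanical : ContinuousOn (mechanicalEnergy A ψ u v) (Ici 0) :=
    ((continuousOn_const.mul (hu.continuousOn_velocity.norm.pow 2)).add
      (continuousOn_const.mul (hu.continuousOn_sqrt.norm.pow 2))).sub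
      (hu.continuousOn_potential hψ)
  exact (h_mechanical.mono Icc_subset_Ici_self).add (continuousOn_const.mul h_window)

end IsSolution

end DelayEstimate

section RunningMaximum

variable {H : Type*} [NormedAddCommGroup H] [InnerProductSpace ℝ H] [CompleteSpace H]
  {W₁ : Type*} [NormedAddCommGroup W₁] [InnerProductSpace ℝ W₁] [CompleteSpace W₁]
  {W₂ : Type*} [NormedAddCommGroup W₂] [InnerProductSpace ℝ W₂] [CompleteSpace W₂]
  {A : H →ₗ.[ℝ] H} {C : W₁ →L[ℝ] H} {B : W₂ →L[ℝ] H} {k τ : ℝ → ℝ} {τbar r s t T : ℝ}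
  {ψ : EnergyDom A → ℝ} {gradψ : EnergyDom A → H} {u₀ : EnergyDom A} {u₁ : H} {g : ℝ → W₂}
  {u : ℝ → EnergyDom A} {v : ℝ → H} {ι : Type*} {e : HilbertBasis ι ℝ H} {l : ι → ℝ}

theorem sq_norm_history_le_energySup (hg : ContinuousOn g (Icc (-τbar) 0))
    (hs : s ∈ Icc (-τbar) 0) : ‖g s‖ ^ 2 ≤ 4 * energySup A B k τbar ψ g u v t := by
  have h_sup : ‖g s‖ ^ 2 ≤ sSup ((fun s => ‖g s‖ ^ 2) '' Icc (-τbar) 0) :=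
    le_csSup (isCompact_Icc.bddAbove_image (hg.norm.pow 2)) (mem_image_of_mem _ hs)
  have h_max : 1 / 4 * sSup ((fun s => ‖g s‖ ^ 2) '' Icc (-τbar) 0) ≤
      energySup A B k τbar ψ g u v t := le_max_left _ _
  linarith

theorem sq_norm_mul_energy_le_energySup
    (hE : ContinuousOn (energy A B k τbar ψ g u v) (Icc 0 t)) (hr : r ∈ Icc 0 t) :
    ‖B‖ ^ 2 * energy A B k τbar ψ g u v r ≤ energySup A B k τbar ψ g u v t :=
  le_max_of_le_right <| mul_le_mul_of_nonneg_left
    (le_csSup (isCompact_Icc.bddAbove_image hE) (mem_image_of_mem _ hr)) (sq_nonneg _)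

theorem monotoneOn_energySup (hE : ContinuousOn (energy A B k τbar ψ g u v) (Icc 0 T)) :
    MonotoneOn (energySup A B k τbar ψ g u v) (Icc 0 T) := fun _ hs _ ht hst =>
  max_le_max_left _ <| mul_le_mul_of_nonneg_left
    (csSup_le_csSup (isCompact_Icc.bddAbove_image (hE.mono (Icc_subset_Icc_right ht.2)))
      ((nonempty_Icc.2 hs.1).image _) (image_mono (Icc_subset_Icc_right hst))) (sq_nonneg _)

theorem energySup_le (hE : ContinuousOn (energy A B k τbar ψ g u v) (Icc 0 t)) (ht : 0 ≤ t)
    {M : ℝ} (h_zero : energySup A B k τbar ψ g u v 0 ≤ M)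
    (hM : ∀ r ∈ Icc 0 t, ‖B‖ ^ 2 * energy A B k τbar ψ g u v r ≤ M) :
    energySup A B k τbar ψ g u v t ≤ M := by
  obtain ⟨r, hr, h_max⟩ := isCompact_Icc.exists_sSup_image_eq (nonempty_Icc.2 ht) hE
  refine max_le ((le_max_left _ _).trans h_zero) ?_
  rw [h_max]
  exact hM r hr

theorem sq_norm_observation_le_energy
    (h_coercive : 1 / 4 * ‖v r‖ ^ 2 ≤ energy A B k τbar ψ g u v r) (hr : 0 ≤ r) :
    ‖observation B g v r‖ ^ 2 ≤ 4 * (‖B‖ ^ 2 * energy A B k τbar ψ g u v r) := by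
  have h_opNorm : ‖observation B g v r‖ ≤ ‖B‖ * ‖v r‖ := by
    rw [observation_of_nonneg hr, ← LinearIsometryEquiv.norm_map ContinuousLinearMap.adjoint B]
    exact B.adjoint.le_opNorm (v r)
  calc ‖observation B g v r‖ ^ 2 ≤ (‖B‖ * ‖v r‖) ^ 2 := by gcongr
    _ = 4 * (‖B‖ ^ 2 * (1 / 4 * ‖v r‖ ^ 2)) := by ring
    _ ≤ 4 * (‖B‖ ^ 2 * energy A B k τbar ψ g u v r) := by gcongr

theorem sq_norm_observation_le_energySup (hg : ContinuousOn g (Icc (-τbar) 0))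
    (hE : ContinuousOn (energy A B k τbar ψ g u v) (Icc 0 t))
    (h_coercive : ∀ s : ℝ, 0 ≤ s → 1 / 4 * ‖v s‖ ^ 2 ≤ energy A B k τbar ψ g u v s)
    (hr : r ∈ Icc (-τbar) t) :
    ‖observation B g v r‖ ^ 2 ≤ 4 * energySup A B k τbar ψ g u v t := by
  rcases lt_or_ge r 0 with h_neg | h_nonneg
  · rw [observation, if_pos h_neg]
    exact sq_norm_history_le_energySup hg ⟨hr.1, h_neg.le⟩
  · refine (sq_norm_observation_le_energy (h_coercive r h_nonneg) h_nonneg).trans ?_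
    gcongr
    exact sq_norm_mul_energy_le_energySup hE ⟨h_nonneg, hr.2⟩

theorem energySup_nonneg (hτbar : 0 ≤ τbar) (hg : ContinuousOn g (Icc (-τbar) 0)) :
    0 ≤ energySup A B k τbar ψ g u v t := by
  have h_history := sq_norm_history_le_energySup (A := A) (B := B) (k := k) (ψ := ψ) (u := u)
    (v := v) (t := t) hg (right_mem_Icc.2 (neg_nonpos.2 hτbar))
  linarith [sq_nonneg ‖g 0‖]

theorem intervalIntegrable_mul_energySup
    (hE : ContinuousOn (energy A B k τbar ψ g u v) (Icc 0 T)) (hT : 0 ≤ T)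
    (hk : IntervalIntegrable k volume 0 T) : IntervalIntegrable
      (fun s => 6 * ‖B‖ ^ 2 * |k s| * energySup A B k τbar ψ g u v s) volume 0 T := by
  refine intervalIntegrable_mul_of_monotoneOn (hk.abs.const_mul _) ?_
  rw [uIcc_of_le hT]
  exact monotoneOn_energySup hE

namespace IsSolution

theorem sq_norm_mul_energy_sub_le (he : IsNonnegEigenbasis A e l)
    (hψ : HasLocallyLipschitzGradient (sqrtOp A) ψ gradψ)
    (hu : IsSolution A C B k τ gradψ u₀ u₁ g u v) (hτ_cont : ContinuousOn τ (Ici 0))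
    (hτ : ∀ t : ℝ, 0 ≤ t → 0 ≤ τ t ∧ τ t ≤ τbar) (hk : LocallyIntegrableOn k (Ici (-τbar)))
    (hg : ContinuousOn g (Icc (-τbar) 0))
    (h_coercive : ∀ t : ℝ, 0 ≤ t → 1 / 4 * ‖v t‖ ^ 2 ≤ energy A B k τbar ψ g u v t)
    (hT : 0 ≤ T) :
    ‖B‖ ^ 2 * (energy A B k τbar ψ g u v T - energy A B k τbar ψ g u v 0) ≤
      ∫ s in (0 : ℝ)..T, 6 * ‖B‖ ^ 2 * |k s| * energySup A B k τbar ψ g u v s := by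
  have hτbar : 0 ≤ τbar := (hτ 0 le_rfl).1.trans (hτ 0 le_rfl).2
  have hE {t : ℝ} (ht : 0 ≤ t) : ContinuousOn (energy A B k τbar ψ g u v) (Icc 0 t) :=
    hu.continuousOn_energy hψ hτbar hk hg ht
  have hkT : IntervalIntegrable k volume 0 T :=
    intervalIntegrable_of_locallyIntegrableOn_Ici hk (by linarith) (by linarith)
  have h_sub : uIcc 0 T ⊆ Ici 0 := by
    rw [uIcc_of_le hT]
    exact Icc_subset_Ici_self
  have h_obs : ContinuousOn (observation B g v) (uIcc 0 T) :=
    (continuousOn_observation hg hu.continuousOn_velocity hu.history).mono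
      (h_sub.trans (Ici_subset_Ici.2 (neg_nonpos.2 hτbar)))
  have h_delay : ContinuousOn (fun s => observation B g v (s - τ s)) (uIcc 0 T) :=
    (continuousOn_observation_sub_delay hg hu.continuousOn_velocity hu.history hτ_cont
      fun t ht => (hτ t ht).2).mono h_sub
  refine (mul_le_mul_of_nonneg_left (hu.energy_sub_le he hψ hτbar hτ_cont
    (fun t ht => (hτ t ht).2) hk hg hT) (sq_nonneg _)).trans ?_
  rw [← intervalIntegral.integral_const_mul]
  refine intervalIntegral.integral_mono_on hT
    ((hkT.abs.mul_continuousOn (by fun_prop)).const_mul _)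
    (intervalIntegrable_mul_energySup (hE hT) hT hkT) fun s hs => ?_
  have h_past : ‖observation B g v (s - τ s)‖ ^ 2 ≤ 4 * energySup A B k τbar ψ g u v s :=
    sq_norm_observation_le_energySup hg (hE hs.1) h_coercive
      ⟨by linarith [hs.1, (hτ s hs.1).2], by linarith [(hτ s hs.1).1]⟩
  have h_present : ‖observation B g v s‖ ^ 2 ≤ 4 * energySup A B k τbar ψ g u v s :=
    sq_norm_observation_le_energySup hg (hE hs.1) h_coercive ⟨by linarith [hs.1], le_rfl⟩
  calc ‖B‖ ^ 2 * (|k s| * (1 / 2 * ‖observation B g v (s - τ s)‖ ^ 2 +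
        ‖observation B g v s‖ ^ 2))
      ≤ ‖B‖ ^ 2 * (|k s| * (1 / 2 * (4 * energySup A B k τbar ψ g u v s) +
        4 * energySup A B k τbar ψ g u v s)) := by gcongr
    _ = 6 * ‖B‖ ^ 2 * |k s| * energySup A B k τbar ψ g u v s := by ring

theorem energySup_le_add_integral (he : IsNonnegEigenbasis A e l)
    (hψ : HasLocallyLipschitzGradient (sqrtOp A) ψ gradψ)
    (hu : IsSolution A C B k τ gradψ u₀ u₁ g u v) (hτ_cont : ContinuousOn τ (Ici 0))
    (hτ : ∀ t : ℝ, 0 ≤ t → 0 ≤ τ t ∧ τ t ≤ τbar) (hk : LocallyIntegrableOn k (Ici (-τbar)))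
    (hg : ContinuousOn g (Icc (-τbar) 0))
    (h_coercive : ∀ t : ℝ, 0 ≤ t → 1 / 4 * ‖v t‖ ^ 2 ≤ energy A B k τbar ψ g u v t)
    (hT : 0 ≤ T) :
    energySup A B k τbar ψ g u v T ≤ energySup A B k τbar ψ g u v 0 +
      ∫ s in (0 : ℝ)..T, 6 * ‖B‖ ^ 2 * |k s| * energySup A B k τbar ψ g u v s := by
  have hτbar : 0 ≤ τbar := (hτ 0 le_rfl).1.trans (hτ 0 le_rfl).2
  have hE : ContinuousOn (energy A B k τbar ψ g u v) (Icc 0 T) :=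
    hu.continuousOn_energy hψ hτbar hk hg hT
  have h_int := intervalIntegrable_mul_energySup hE hT
    (intervalIntegrable_of_locallyIntegrableOn_Ici hk (by linarith) (by linarith))
  have h_nonneg (s : ℝ) : 0 ≤ 6 * ‖B‖ ^ 2 * |k s| * energySup A B k τbar ψ g u v s :=
    mul_nonneg (by positivity) (energySup_nonneg hτbar hg)
  refine energySup_le hE hT (le_add_of_nonneg_right
    (intervalIntegral.integral_nonneg hT fun s _ => h_nonneg s)) fun r hr => ?_
  have h_zero : ‖B‖ ^ 2 * energy A B k τbar ψ g u v 0 ≤ energySup A B k τbar ψ g u v 0 :=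
    sq_norm_mul_energy_le_energySup (hE.mono (Icc_subset_Icc_right hT)) (left_mem_Icc.2 le_rfl)
  calc ‖B‖ ^ 2 * energy A B k τbar ψ g u v r
      = ‖B‖ ^ 2 * energy A B k τbar ψ g u v 0 +
        ‖B‖ ^ 2 * (energy A B k τbar ψ g u v r - energy A B k τbar ψ g u v 0) := by ring
    _ ≤ energySup A B k τbar ψ g u v 0 +
        ∫ s in (0 : ℝ)..r, 6 * ‖B‖ ^ 2 * |k s| * energySup A B k τbar ψ g u v s :=
      add_le_add h_zero
        (hu.sq_norm_mul_energy_sub_le he hψ hτ_cont hτ hk hg h_coercive hr.1)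
    _ ≤ energySup A B k τbar ψ g u v 0 +
        ∫ s in (0 : ℝ)..T, 6 * ‖B‖ ^ 2 * |k s| * energySup A B k τbar ψ g u v s := by
      gcongr
      exact intervalIntegral.integral_mono_interval le_rfl hr.1 hr.2 (.of_forall h_nonneg) h_int

theorem energySup_le_mul_exp (he : IsNonnegEigenbasis A e l)
    (hψ : HasLocallyLipschitzGradient (sqrtOp A) ψ gradψ)
    (hu : IsSolution A C B k τ gradψ u₀ u₁ g u v) (hτ_cont : ContinuousOn τ (Ici 0))
    (hτ : ∀ t : ℝ, 0 ≤ t → 0 ≤ τ t ∧ τ t ≤ τbar) (hk : LocallyIntegrableOn k (Ici (-τbar)))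
    (hg : ContinuousOn g (Icc (-τbar) 0))
    (h_coercive : ∀ t : ℝ, 0 ≤ t → 1 / 4 * ‖v t‖ ^ 2 ≤ energy A B k τbar ψ g u v t)
    (hT : 0 ≤ T) :
    energySup A B k τbar ψ g u v T ≤ energySup A B k τbar ψ g u v 0 *
      Real.exp (6 * ‖B‖ ^ 2 * ∫ s in (0 : ℝ)..T, |k s|) := by
  have hτbar : 0 ≤ τbar := (hτ 0 le_rfl).1.trans (hτ 0 le_rfl).2
  have hkT : IntervalIntegrable k volume 0 T :=
    intervalIntegrable_of_locallyIntegrableOn_Ici hk (by linarith) (by linarith)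
  rw [← intervalIntegral.integral_const_mul]
  exact le_mul_exp_integral_of_le_add_integral hT (hkT.abs.const_mul _)
    (intervalIntegrable_mul_energySup (hu.continuousOn_energy hψ hτbar hk hg hT) hT hkT)
    (fun s _ => by positivity) fun t ht =>
      hu.energySup_le_add_integral he hψ hτ_cont hτ hk hg h_coercive ht.1

end IsSolution

end RunningMaximum

end DelayWave

theorem proposition2p1_general
    {H : Type*} [NormedAddCommGroup H] [InnerProductSpace ℝ H] [CompleteSpace H]
    {W₁ : Type*} [NormedAddCommGroup W₁] [InnerProductSpace ℝ W₁] [CompleteSpace W₁]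
    {W₂ : Type*} [NormedAddCommGroup W₂] [InnerProductSpace ℝ W₂] [CompleteSpace W₂]
    {ι : Type*} (A : H →ₗ.[ℝ] H) (e : HilbertBasis ι ℝ H) (l : ι → ℝ)
    (he : DelayWave.IsNonnegEigenbasis A e l)
    (C : W₁ →L[ℝ] H) (B : W₂ →L[ℝ] H) (hB : B ≠ 0)
    (τbar : ℝ) (τ : ℝ → ℝ) (hτ_cont : ContinuousOn τ (Ici 0))
    (hτ : ∀ t : ℝ, 0 ≤ t → 0 ≤ τ t ∧ τ t ≤ τbar)
    (k : ℝ → ℝ) (hk : LocallyIntegrableOn k (Ici (-τbar)))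
    (ψ : DelayWave.EnergyDom A → ℝ) (gradψ : DelayWave.EnergyDom A → H)
    (hψ : DelayWave.HasLocallyLipschitzGradient (DelayWave.sqrtOp A) ψ gradψ)
    (u₀ : DelayWave.EnergyDom A) (u₁ : H) (g : ℝ → W₂) (hg : ContinuousOn g (Icc (-τbar) 0))
    (u : ℝ → DelayWave.EnergyDom A) (v : ℝ → H)
    (hu : DelayWave.IsSolution A C B k τ gradψ u₀ u₁ g u v)
    (hE : ∀ t : ℝ, 0 ≤ t → 1 / 4 * ‖v t‖ ^ 2 ≤ DelayWave.energy A B k τbar ψ g u v t) :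
    ∀ t : ℝ, 0 ≤ t →
      DelayWave.energy A B k τbar ψ g u v t ≤
        1 / ‖B‖ ^ 2 * Real.exp (6 * ‖B‖ ^ 2 * ∫ s in (0 : ℝ)..t, |k s|) *
          DelayWave.energySup A B k τbar ψ g u v 0 := by
  intro t ht
  have hτbar : 0 ≤ τbar := (hτ 0 le_rfl).1.trans (hτ 0 le_rfl).2
  have h_le_sup := DelayWave.sq_norm_mul_energy_le_energySup
    (hu.continuousOn_energy hψ hτbar hk hg ht) (right_mem_Icc.2 ht)
  have h_gronwall := hu.energySup_le_mul_exp he hψ hτ_cont hτ hk hg hE ht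
  rw [one_div, mul_assoc, le_inv_mul_iff₀ (pow_pos (norm_pos_iff.2 hB) 2), mul_comm (Real.exp _)]
  exact h_le_sup.trans h_gronwall

theorem proposition2p1
    {H : Type*} [NormedAddCommGroup H] [InnerProductSpace ℝ H] [CompleteSpace H]
    {W₁ : Type*} [NormedAddCommGroup W₁] [InnerProductSpace ℝ W₁] [CompleteSpace W₁]
    {W₂ : Type*} [NormedAddCommGroup W₂] [InnerProductSpace ℝ W₂] [CompleteSpace W₂]
    (A : H →ₗ.[ℝ] H) (hA : DelayWave.IsAdmissible A)
    (C : W₁ →L[ℝ] H) (B : W₂ →L[ℝ] H) (hB : B ≠ 0)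
    (τbar : ℝ) (τ : ℝ → ℝ) (hτ_cont : ContinuousOn τ (Ici 0))
    (hτ : ∀ t : ℝ, 0 ≤ t → 0 ≤ τ t ∧ τ t ≤ τbar)
    (k : ℝ → ℝ) (hk : LocallyIntegrableOn k (Ici (-τbar)))
    (ψ : DelayWave.EnergyDom A → ℝ) (gradψ : DelayWave.EnergyDom A → H)
    (hψ : DelayWave.IsPotential A ψ gradψ)
    (u₀ : DelayWave.EnergyDom A) (u₁ : H) (g : ℝ → W₂) (hg : ContinuousOn g (Icc (-τbar) 0))
    (u : ℝ → DelayWave.EnergyDom A) (v : ℝ → H)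
    (hu : DelayWave.IsSolution A C B k τ gradψ u₀ u₁ g u v)
    (hE : ∀ t : ℝ, 0 ≤ t → 1 / 4 * ‖v t‖ ^ 2 ≤ DelayWave.energy A B k τbar ψ g u v t) :
    ∀ t : ℝ, 0 ≤ t →
      DelayWave.energy A B k τbar ψ g u v t ≤
        1 / ‖B‖ ^ 2 * Real.exp (6 * ‖B‖ ^ 2 * ∫ s in (0 : ℝ)..t, |k s|) *
          DelayWave.energySup A B k τbar ψ g u v 0 := by
  obtain ⟨ι, e, l, he⟩ := hA.exists_isNonnegEigenbasis
  exact proposition2p1_general A e l he C B hB τbar τ hτ_cont hτ k hk ψ gradψ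
    hψ.hasLocallyLipschitzGradient u₀ u₁ g hg u v hu hE
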